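/- For $n\ge 1$ let \[ B_n=\sum_{k=1}^{n}\frac{2}{n(n+1)^2}\binom{n+1}{k-1}\binom{n+1}{k}\binom{n+1}{k+1} \] be the $n$-th Baxter number. For a real sequence $\{a_n\}_{n\ge n_0}$ let $\mathscr{L}(\{a_n\}_{n\ge n_0})=\{a_na_{n+2}-a_{n+1}^2\}_{n\ge n_0}$, and let $\mathscr{L}^j$ denote the $j$-th iterate of $\mathscr{L}$. For an integer $r\ge 1$, the sequence $\{a_n\}_{n\ge n_0}$ is called $r$-log-convex if, for every $1\le j\le r$, all terms of $\mathscr{L}^j(\{a_n\}_{n\ge n_0})$ are nonnegative; it is called asymptotically $r$-log-convex if, for every $1\le j\le r$, all but finitely many terms of $\mathscr{L}^j(\{a_n\}_{n\ge n_0})$ are nonnegative. Theorem. The sequence $\{B_n\}_{n\ge 1}$ is asymptotically $r$-log-convex for every integer $r\ge 1$. Moreover, the sequence $\{B_n\}_{n\ge 1}$ is $2$-log-convex. -/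

import Mathlib

/-- The number `D_{n,k} = 2 / (n (n+1)^2) * C(n+1,k-1) * C(n+1,k) * C(n+1,k+1)`,
for `1 ≤ k ≤ n` (the only range in which it is used). -/
noncomputable def baxterTerm (n k : ℕ) : ℝ :=
  2 / ((n : ℝ) * ((n : ℝ) + 1) ^ 2) *
    ((n + 1).choose (k - 1) : ℝ) * ((n + 1).choose k : ℝ) * ((n + 1).choose (k + 1) : ℝ)

/-- The `n`-th Baxter number `B_n`, for `n ≥ 1`, as the sum of `D_{n,k}` over `1 ≤ k ≤ n`.
The value at `n = 0` is meaningless and never used. -/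
noncomputable def baxter (n : ℕ) : ℝ :=
  ∑ k ∈ Finset.Icc 1 n, baxterTerm n k

/-- The sequence `{B_n}_{n ≥ 1}`, reindexed so that its initial term `B_1` has index `0`. -/
noncomputable def baxterSeq (i : ℕ) : ℝ := baxter (i + 1)

/-- The operator `{a_n} ↦ {a_n a_{n+2} - a_{n+1}^2}` on infinite real sequences. -/
def logConvexOp (a : ℕ → ℝ) : ℕ → ℝ :=
  fun n => a n * a (n + 2) - a (n + 1) ^ 2

/-- `a` is `r`-log-convex: for every `1 ≤ j ≤ r`, the `j`-th iterate of `logConvexOp`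
on `a` is a nonnegative sequence. -/
def IsRLogConvex (r : ℕ) (a : ℕ → ℝ) : Prop :=
  ∀ j : ℕ, 1 ≤ j → j ≤ r → ∀ n : ℕ, 0 ≤ logConvexOp^[j] a n

/-- `a` is asymptotically `r`-log-convex: for every `1 ≤ j ≤ r`, the `j`-th iterate of
`logConvexOp` on `a` is nonnegative for all but finitely many initial terms. -/
def IsAsymptoticallyRLogConvex (r : ℕ) (a : ℕ → ℝ) : Prop :=
  ∀ j : ℕ, 1 ≤ j → j ≤ r → ∃ N : ℕ, ∀ n : ℕ, N ≤ n → 0 ≤ logConvexOp^[j] a n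

/-! Zeilberger's method gives a three-term recurrence for `B_n`, hence a first-order recurrence for
the ratios `q_n = B_{n+1}/B_n`. Both claims are read off from `q_n`, through the excess `x_n = B_n
B_{n+2}/B_{n+1}² - 1`.

For 2-log-convexity, explicit rational bounds on `q_n` propagate along the recurrence and give
bounds on `x_n`. Positivity of `x_n` is the first order; the second is `x_{n+1}² ≤ (1 + x_{n+1})²
x_n x_{n+2}` (`baxterExcess_sq_le`).

For the asymptotic claim, `q_n` has an expansion in powers of `1/n` to every order
(`HasInvExpansion.of_recurrence`), so `B_n B_{n+2}/B_{n+1}² = 1 + c/n² + ⋯` with `c > 0`. This shape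
survives the operator, with `c` replaced by `2c + 2`, so every iterate is eventually positive. -/

/-! ### The three-term recurrence -/

/-- Product of three consecutive binomial coefficients. -/
noncomputable def tripleChoose (m j : ℕ) : ℝ :=
  (m.choose j : ℝ) * (m.choose (j + 1) : ℝ) * (m.choose (j + 2) : ℝ)

theorem cast_choose_succ_left (m k : ℕ) :
    (m.choose k : ℝ) = ((m + 1).choose k : ℝ) * (m + 1 - k) / (m + 1) := by
  have hm : (m : ℝ) + 1 ≠ 0 := by positivity
  rw [eq_div_iff hm]
  rcases le_or_gt k (m + 1) with h | h
  · have := Nat.choose_mul_succ_eq m k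
    have h2 := congrArg (Nat.cast : ℕ → ℝ) this
    push_cast [Nat.cast_sub h] at h2
    exact h2
  · rw [Nat.choose_eq_zero_of_lt h, Nat.choose_eq_zero_of_lt (by omega)]
    simp

theorem cast_choose_succ_right (m k : ℕ) :
    (m.choose (k + 1) : ℝ) * (k + 1) = (m.choose k : ℝ) * (m - k) := by
  rcases le_or_gt k m with h | h
  · have := Nat.choose_succ_right_eq m k
    have h2 := congrArg (Nat.cast : ℕ → ℝ) this
    push_cast [Nat.cast_sub h] at h2
    exact h2
  · rw [Nat.choose_eq_zero_of_lt h, Nat.choose_eq_zero_of_lt (by omega)]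
    simp

/-- The `d` extra terms vanish; they let three consecutive Baxter numbers be summed over one common
range. -/
theorem baxter_eq_sum_range (n d : ℕ) :
    baxter n = ∑ j ∈ Finset.range (n + d),
      2 / ((n : ℝ) * ((n : ℝ) + 1) ^ 2) * tripleChoose (n + 1) j := by
  have h1 : baxter n = ∑ j ∈ Finset.range n,
      2 / ((n : ℝ) * ((n : ℝ) + 1) ^ 2) * tripleChoose (n + 1) j := by
    unfold baxter
    rw [Finset.range_eq_Ico, Finset.sum_Ico_eq_sum_range, ← Finset.Ico_add_one_right_eq_Icc,
      Finset.sum_Ico_eq_sum_range]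
    refine Finset.sum_congr (by simp) fun j _ => ?_
    simp only [baxterTerm, tripleChoose, add_comm 1 j, zero_add, Nat.add_sub_cancel]
    ring_nf
  rw [h1, Finset.sum_range_add, left_eq_add]
  refine Finset.sum_eq_zero fun j _ => ?_
  rw [tripleChoose, Nat.choose_eq_zero_of_lt (n := n + 1) (k := n + j + 2) (by omega)]
  simp

/-- The antidifference in Zeilberger's telescoping of the Baxter recurrence. -/
noncomputable def baxterCertificate (n j : ℕ) : ℝ :=
  2 * (4 * (j : ℝ) ^ 3 - (36 + 18 * n) * j ^ 2 + (110 + 111 * n + 27 * n ^ 2) * j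
      - (118 + 181 * n + 89 * n ^ 2 + 14 * n ^ 3)) * (j * (j + 1) * (j + 2))
    / ((n + 3) ^ 3 * (n + 2) ^ 3 * (n + 1)) * tripleChoose (n + 3) j

theorem tripleChoose_succ_right (m j : ℕ) :
    ((j : ℝ) + 1) * (j + 2) * (j + 3) * tripleChoose m (j + 1) =
      (m - j) * (m - j - 1) * (m - j - 2) * tripleChoose m j := by
  have h1 := cast_choose_succ_right m j
  have h2 := cast_choose_succ_right m (j + 1)
  have h3 := cast_choose_succ_right m (j + 2)
  push_cast at h2 h3
  unfold tripleChoose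
  calc _ = ((m.choose (j + 1) : ℝ) * (j + 1)) * ((m.choose (j + 1 + 1) : ℝ) * (j + 1 + 1)) *
        ((m.choose (j + 2 + 1) : ℝ) * (j + 2 + 1)) := by ring_nf
    _ = _ := by rw [h1, h2, h3]; ring

theorem tripleChoose_succ_left (m j : ℕ) :
    tripleChoose m j =
      (m + 1 - j) * (m - j) * (m - j - 1) / (m + 1) ^ 3 * tripleChoose (m + 1) j := by
  unfold tripleChoose
  have hm : (m : ℝ) + 1 ≠ 0 := by positivity
  rw [cast_choose_succ_left m j, cast_choose_succ_left m (j + 1), cast_choose_succ_left m (j + 2)]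
  push_cast
  field_simp
  ring

/-- Every term is a multiple of `tripleChoose (n + 3) j` whose coefficient is polynomial in `j`, so
a single identity of rational functions in `n` and `j` remains, with no boundary cases in `j`. -/
theorem baxterCertificate_telescopes (n j : ℕ) (hn : 1 ≤ n) :
    ((n : ℝ) + 4) * (n + 5) *
        (2 / (((n + 2 : ℕ) : ℝ) * (((n + 2 : ℕ) : ℝ) + 1) ^ 2) * tripleChoose (n + 2 + 1) j)
      - (7 * n ^ 2 + 35 * n + 40) *
        (2 / (((n + 1 : ℕ) : ℝ) * (((n + 1 : ℕ) : ℝ) + 1) ^ 2) * tripleChoose (n + 1 + 1) j)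
      - 8 * n * (n + 1) * (2 / ((n : ℝ) * ((n : ℝ) + 1) ^ 2) * tripleChoose (n + 1) j)
      = baxterCertificate n (j + 1) - baxterCertificate n j := by
  have hn0 : (n : ℝ) ≠ 0 := by positivity
  have e : baxterCertificate n (j + 1) =
      2 * (4 * ((j : ℝ) + 1) ^ 3 - (36 + 18 * n) * (j + 1) ^ 2
        + (110 + 111 * n + 27 * n ^ 2) * (j + 1)
        - (118 + 181 * n + 89 * n ^ 2 + 14 * n ^ 3))
      / ((n + 3) ^ 3 * (n + 2) ^ 3 * (n + 1)) *
      ((n + 3 - j) * (n + 3 - j - 1) * (n + 3 - j - 2) * tripleChoose (n + 3) j) := by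
    have := tripleChoose_succ_right (n + 3) j
    push_cast at this
    rw [← this, baxterCertificate]
    push_cast
    ring
  rw [e, tripleChoose_succ_left (n + 1) j, tripleChoose_succ_left (n + 1 + 1) j, baxterCertificate]
  simp only [add_assoc, Nat.reduceAdd]
  generalize tripleChoose (n + 3) j = c
  push_cast
  have h1 : (n : ℝ) + 1 ≠ 0 := by positivity
  have h2 : (n : ℝ) + 2 ≠ 0 := by positivity
  have h3 : (n : ℝ) + 3 ≠ 0 := by positivity
  have h1' : (n : ℝ) + 1 + 1 = n + 2 := by ring
  have h2' : (n : ℝ) + 2 + 1 = n + 3 := by ring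
  norm_num [add_assoc]
  field_simp
  ring

theorem baxter_recurrence (n : ℕ) (hn : 1 ≤ n) :
    ((n : ℝ) + 4) * (n + 5) * baxter (n + 2) =
      (7 * n ^ 2 + 35 * n + 40) * baxter (n + 1) + 8 * n * (n + 1) * baxter n := by
  have key : ((n : ℝ) + 4) * (n + 5) * baxter (n + 2) - (7 * n ^ 2 + 35 * n + 40) * baxter (n + 1)
      - 8 * n * (n + 1) * baxter n = 0 := by
    rw [baxter_eq_sum_range (n + 2) 0, baxter_eq_sum_range (n + 1) 1, baxter_eq_sum_range n 2,
      Finset.mul_sum, Finset.mul_sum, Finset.mul_sum, add_zero, show n + 1 + 1 = n + 2 from rfl,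
      ← Finset.sum_sub_distrib, ← Finset.sum_sub_distrib,
      Finset.sum_congr rfl fun j _ => baxterCertificate_telescopes n j hn,
      Finset.sum_range_sub]
    -- Both ends vanish: at `j = 0` by the factor `j`, at `j = n + 2` because `C(n+3, n+4) = 0`.
    simp [baxterCertificate, tripleChoose]
  linarith

theorem baxter_pos (n : ℕ) (hn : 1 ≤ n) : 0 < baxter n := by
  unfold baxter
  refine Finset.sum_pos (fun k hk => ?_) ⟨1, by simpa⟩
  rw [Finset.mem_Icc] at hk
  have h1 : 0 < (n + 1).choose (k - 1) := Nat.choose_pos (by omega)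
  have h2 : 0 < (n + 1).choose k := Nat.choose_pos (by omega)
  have h3 : 0 < (n + 1).choose (k + 1) := Nat.choose_pos (by omega)
  unfold baxterTerm
  positivity

theorem baxter_one : baxter 1 = 1 := by
  norm_num [baxter, baxterTerm]

theorem baxter_two : baxter 2 = 2 := by
  norm_num [baxter, baxterTerm, Finset.sum_Icc_succ_top, Nat.choose]

theorem baxter_three : baxter 3 = 6 := by
  have := baxter_recurrence 1 le_rfl
  norm_num [baxter_one, baxter_two] at this
  linarith

theorem baxter_four : baxter 4 = 22 := by
  have := baxter_recurrence 2 (by norm_num)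
  norm_num [baxter_three, baxter_two] at this
  linarith

theorem baxter_five : baxter 5 = 92 := by
  have := baxter_recurrence 3 (by norm_num)
  norm_num [baxter_three, baxter_four] at this
  linarith

/-! ### Bounds for consecutive ratios -/

/-- The ratio of consecutive Baxter numbers. -/
noncomputable def baxterRatio (n : ℕ) : ℝ := baxter (n + 1) / baxter n

theorem baxterRatio_pos (n : ℕ) (hn : 1 ≤ n) : 0 < baxterRatio n :=
  div_pos (baxter_pos _ (by omega)) (baxter_pos _ hn)

theorem baxterRatio_succ (n : ℕ) (hn : 1 ≤ n) :
    baxterRatio (n + 1) =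
      (7 * n ^ 2 + 35 * n + 40 + 8 * n * (n + 1) / baxterRatio n) / ((n + 4) * (n + 5)) := by
  have h0 := (baxter_pos n hn).ne'
  have h1 := (baxter_pos (n + 1) (by omega)).ne'
  have h := baxter_recurrence n hn
  have hD : ((n : ℝ) + 4) * (n + 5) ≠ 0 := by positivity
  rw [eq_div_iff hD]
  unfold baxterRatio
  field_simp
  linarith

/-- Lower bound for `baxterRatio n`, as a function of `n + 3`. -/
noncomputable def ratioLower (w : ℝ) : ℝ :=
  (216 * w ^ 4 - 864 * w ^ 3 + 1152 * w ^ 2 - 1216 * w + 540) / (27 * w ^ 4)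

/-- Upper bound for `baxterRatio n`, as a function of `n + 3`. -/
noncomputable def ratioUpper (w : ℝ) : ℝ :=
  (216 * w ^ 4 - 864 * w ^ 3 + 1152 * w ^ 2 - 1216 * w + 1620) / (27 * w ^ 4)

theorem ratioLower_numerator_pos {m : ℝ} (hm : 0 ≤ m) :
    0 < 216 * (m + 5) ^ 4 - 864 * (m + 5) ^ 3 + 1152 * (m + 5) ^ 2 - 1216 * (m + 5) + 540 := by
  ring_nf
  positivity

theorem ratioUpper_numerator_pos {m : ℝ} (hm : 0 ≤ m) :
    0 < 216 * (m + 5) ^ 4 - 864 * (m + 5) ^ 3 + 1152 * (m + 5) ^ 2 - 1216 * (m + 5) + 1620 := by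
  ring_nf
  positivity

theorem ratioLower_pos {m : ℝ} (hm : 0 ≤ m) : 0 < ratioLower (m + 5) := by
  have := ratioLower_numerator_pos hm
  unfold ratioLower
  positivity

theorem ratioLower_succ_le {m : ℝ} (hm : 0 ≤ m) :
    ratioLower (m + 6) ≤ (7 * (m + 2) ^ 2 + 35 * (m + 2) + 40 +
      8 * (m + 2) * (m + 3) / ratioUpper (m + 5)) / ((m + 6) * (m + 7)) := by
  have h := ratioUpper_numerator_pos hm
  unfold ratioLower ratioUpper
  rw [div_div_eq_mul_div, add_div' _ _ _ h.ne', div_div, div_le_div_iff₀ (by positivity)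
    (by positivity), ← sub_nonneg]
  -- Expanded in `m = w - 5`, the cleared difference has only nonnegative coefficients; the later
  -- rational inequalities are settled the same way.
  ring_nf
  positivity

theorem le_ratioUpper_succ {m : ℝ} (hm : 0 ≤ m) :
    (7 * (m + 2) ^ 2 + 35 * (m + 2) + 40 +
      8 * (m + 2) * (m + 3) / ratioLower (m + 5)) / ((m + 6) * (m + 7)) ≤ ratioUpper (m + 6) := by
  have h := ratioLower_numerator_pos hm
  unfold ratioLower ratioUpper
  rw [div_div_eq_mul_div, add_div' _ _ _ h.ne', div_div, div_le_div_iff₀ (by positivity)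
    (by positivity), ← sub_nonneg]
  ring_nf
  positivity

/-- The recurrence map decreases in the ratio, so each bound at one index yields the opposite bound
at the next. With `w = n + 3` both bounds are `8 - 32/w + 128/(3w²) - 1216/(27w³)` plus `20/w⁴` or
`60/w⁴`. -/
theorem baxterRatio_bounds (m : ℕ) :
    ratioLower (m + 5) ≤ baxterRatio (m + 2) ∧ baxterRatio (m + 2) ≤ ratioUpper (m + 5) := by
  induction m with
  | zero => norm_num [ratioLower, ratioUpper, baxterRatio, baxter_two, baxter_three]
  | succ m ih =>
    have hm : (0 : ℝ) ≤ m := m.cast_nonneg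
    have hl := ratioLower_pos hm
    have hq := baxterRatio_pos (m + 2) (by omega)
    have e : baxterRatio (m + 1 + 2) = (7 * ((m : ℝ) + 2) ^ 2 + 35 * (m + 2) + 40 +
        8 * (m + 2) * (m + 3) / baxterRatio (m + 2)) / ((m + 6) * (m + 7)) := by
      have := baxterRatio_succ (m + 2) (by omega)
      rw [show m + 1 + 2 = m + 2 + 1 by ring, this]
      push_cast
      ring_nf
    have e2 : (((m + 1 : ℕ) : ℝ) + 5) = m + 6 := by push_cast; ring
    rw [e, e2]
    constructor
    · refine (ratioLower_succ_le hm).trans ?_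
      gcongr
      exact ih.2
    · refine le_trans ?_ (le_ratioUpper_succ hm)
      gcongr
      exact ih.1

/-! ### Bounds for the excess -/

/-- `baxter n * baxter (n + 2) / baxter (n + 1) ^ 2 - 1`. -/
noncomputable def baxterExcess (n : ℕ) : ℝ := baxterRatio (n + 1) / baxterRatio n - 1

/-- Lower bound for `baxterExcess n`, as a function of `n + 3`. -/
noncomputable def excessLower (w : ℝ) : ℝ := (12 * w ^ 2 + 4 * w + 42) / (3 * w ^ 4)

/-- Upper bound for `baxterExcess n`, as a function of `n + 3`. -/
noncomputable def excessUpper (w : ℝ) : ℝ := (12 * w ^ 2 + 4 * w + 102) / (3 * w ^ 4)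

theorem excessLower_le_of_ratioUpper {m : ℝ} (hm : 0 ≤ m) :
    excessLower (m + 5) + 1 ≤ (7 * (m + 2) ^ 2 + 35 * (m + 2) + 40 +
      8 * (m + 2) * (m + 3) / ratioUpper (m + 5)) / ((m + 6) * (m + 7)) / ratioUpper (m + 5) := by
  have h := ratioUpper_numerator_pos hm
  unfold excessLower ratioUpper
  rw [div_div_eq_mul_div (8 * (m + 2) * (m + 3)), add_div' _ _ _ h.ne', div_div, mul_div_assoc',
    div_div_div_eq, div_add_one (by positivity),
    div_le_div_iff₀ (by positivity) (by positivity), ← sub_nonneg]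
  ring_nf
  positivity

theorem le_excessUpper_of_ratioLower {m : ℝ} (hm : 0 ≤ m) :
    (7 * (m + 3) ^ 2 + 35 * (m + 3) + 40 +
      8 * (m + 3) * (m + 4) / ratioLower (m + 6)) / ((m + 7) * (m + 8)) / ratioLower (m + 6) ≤
      excessUpper (m + 6) + 1 := by
  have h := ratioLower_numerator_pos (add_nonneg hm zero_le_one)
  have e : m + 1 + 5 = m + 6 := by ring
  rw [e] at h
  unfold excessUpper ratioLower
  rw [div_div_eq_mul_div (8 * (m + 3) * (m + 4)), add_div' _ _ _ h.ne', div_div, mul_div_assoc',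
    div_div_div_eq, div_add_one (by positivity),
    div_le_div_iff₀ (by positivity) (by positivity), ← sub_nonneg]
  ring_nf
  positivity

theorem baxterExcess_eq (n : ℕ) (hn : 1 ≤ n) :
    baxterExcess n = (7 * n ^ 2 + 35 * n + 40 + 8 * n * (n + 1) / baxterRatio n) /
      ((n + 4) * (n + 5)) / baxterRatio n - 1 := by
  rw [baxterExcess, baxterRatio_succ n hn]

theorem excessLower_le_baxterExcess (m : ℕ) : excessLower (m + 5) ≤ baxterExcess (m + 2) := by
  have hm : (0 : ℝ) ≤ m := m.cast_nonneg
  have hq := baxterRatio_pos (m + 2) (by omega)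
  rw [baxterExcess_eq _ (by omega), le_sub_iff_add_le]
  refine (excessLower_le_of_ratioUpper hm).trans ?_
  have hb := (baxterRatio_bounds m).2
  push_cast
  have e1 : (m : ℝ) + 2 + 1 = m + 3 := by ring
  have e2 : (m : ℝ) + 2 + 4 = m + 6 := by ring
  have e3 : (m : ℝ) + 2 + 5 = m + 7 := by ring
  rw [e1, e2, e3]
  gcongr

theorem baxterExcess_le_excessUpper (m : ℕ) : baxterExcess (m + 3) ≤ excessUpper (m + 6) := by
  have hm : (0 : ℝ) ≤ m := m.cast_nonneg
  have hq := baxterRatio_pos (m + 3) (by omega)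
  rw [baxterExcess_eq _ (by omega), sub_le_iff_le_add]
  refine le_trans ?_ (le_excessUpper_of_ratioLower hm)
  have hb := (baxterRatio_bounds (m + 1)).1
  have hl := ratioLower_pos (add_nonneg hm zero_le_one)
  push_cast at hb ⊢
  have e1 : (m : ℝ) + 3 + 1 = m + 4 := by ring
  have e2 : (m : ℝ) + 3 + 4 = m + 7 := by ring
  have e3 : (m : ℝ) + 3 + 5 = m + 8 := by ring
  have e4 : (m : ℝ) + 1 + 5 = m + 6 := by ring
  rw [e4] at hl hb
  rw [e1, e2, e3]
  gcongr

/-- With `w = m + 6`, the ratio of the two sides gains `8/w²` from the factor `(1 + x)²` and `2/w²`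
from the spacing, and loses `10/w²` to the gap between the bounds; the positive `1/w³` term decides
for large `w`. -/
theorem excessUpper_sq_le {m : ℝ} (hm : 0 ≤ m) :
    excessUpper (m + 6) ^ 2 ≤
      (excessUpper (m + 6) + 1) ^ 2 * (excessLower (m + 5) * excessLower (m + 7)) := by
  unfold excessUpper excessLower
  rw [div_add_one (by positivity), div_pow, div_pow, div_mul_div_comm, div_mul_div_comm,
    div_le_div_iff₀ (by positivity) (by positivity), ← sub_nonneg]
  ring_nf
  positivity

theorem baxterExcess_pos (m : ℕ) : 0 < baxterExcess (m + 2) := by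
  refine lt_of_lt_of_le ?_ (excessLower_le_baxterExcess m)
  unfold excessLower
  positivity

/-- Since `t/(t + 1)` increases in `t`, the middle excess may be replaced by its upper bound and the
outer two by their lower bounds. -/
theorem baxterExcess_sq_le (m : ℕ) :
    baxterExcess (m + 3) ^ 2 ≤
      (baxterExcess (m + 3) + 1) ^ 2 * (baxterExcess (m + 2) * baxterExcess (m + 4)) := by
  have hm : (0 : ℝ) ≤ m := m.cast_nonneg
  have ht := baxterExcess_pos (m + 1)
  have hC := baxterExcess_le_excessUpper m
  have h0 := excessLower_le_baxterExcess m
  have h2 := excessLower_le_baxterExcess (m + 2)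
  have hA := excessUpper_sq_le hm
  have e : (((m + 2 : ℕ) : ℝ) + 5) = m + 7 := by push_cast; ring
  rw [e] at h2
  rw [show m + 1 + 2 = m + 3 by ring] at ht
  rw [show m + 2 + 2 = m + 4 by ring] at h2
  have p0 : 0 < excessLower ((m : ℝ) + 5) := by unfold excessLower; positivity
  have p2 : 0 < excessLower ((m : ℝ) + 7) := by unfold excessLower; positivity
  have hC0 := ht.trans_le hC
  set t := baxterExcess (m + 3)
  set C := excessUpper ((m : ℝ) + 6)
  set a := excessLower ((m : ℝ) + 5) * excessLower ((m : ℝ) + 7) with ha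
  have hap : 0 < a := mul_pos p0 p2
  have hx : t ^ 2 * C ^ 2 ≤ C ^ 2 * ((t + 1) ^ 2 * a) := by
    calc t ^ 2 * C ^ 2 ≤ t ^ 2 * ((C + 1) ^ 2 * a) := by gcongr
      _ = (t * (C + 1)) ^ 2 * a := by ring
      _ ≤ (C * (t + 1)) ^ 2 * a := by
        have : t * (C + 1) ≤ C * (t + 1) := by linarith
        gcongr ?_ ^ 2 * a
      _ = _ := by ring
  have : t ^ 2 ≤ (t + 1) ^ 2 * a := by
    rw [mul_comm] at hx
    exact le_of_mul_le_mul_left hx (by positivity)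
  refine this.trans ?_
  have p0' := p0.trans_le h0
  rw [ha]
  gcongr

/-! ### 2-log-convexity -/

theorem logConvexOp_baxter (n : ℕ) (hn : 1 ≤ n) :
    logConvexOp baxter n = baxter (n + 1) ^ 2 * baxterExcess n := by
  have h0 := (baxter_pos n hn).ne'
  have h1 := (baxter_pos (n + 1) (by omega)).ne'
  have h2 := (baxter_pos (n + 2) (by omega)).ne'
  unfold logConvexOp baxterExcess baxterRatio
  rw [show n + 1 + 1 = n + 2 from rfl]
  field_simp

theorem logConvexOp_shift (a : ℕ → ℝ) (d : ℕ) :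
    logConvexOp (fun i => a (i + d)) = fun i => logConvexOp a (i + d) := by
  funext i
  simp only [logConvexOp]
  rw [show i + 2 + d = i + d + 2 by ring, show i + 1 + d = i + d + 1 by ring]

theorem logConvexOp_baxterSeq_nonneg (i : ℕ) : 0 ≤ logConvexOp baxterSeq i := by
  have e : logConvexOp baxterSeq i = logConvexOp baxter (i + 1) :=
    congrFun (logConvexOp_shift baxter 1) i
  rw [e]
  cases i with
  | zero => norm_num [logConvexOp, baxter_one, baxter_two, baxter_three]
  | succ m =>
    rw [logConvexOp_baxter _ (by omega)]
    have := baxterExcess_pos m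
    positivity

theorem logConvexOp_logConvexOp_baxterSeq_nonneg (i : ℕ) :
    0 ≤ logConvexOp (logConvexOp baxterSeq) i := by
  have e : logConvexOp baxterSeq = fun i => logConvexOp baxter (i + 1) :=
    logConvexOp_shift baxter 1
  rw [e, logConvexOp_shift]
  cases i with
  | zero =>
    -- The excess bounds begin at `n = 2`, so the first term is computed from `B_1, …, B_5`.
    norm_num [logConvexOp, baxter_one, baxter_two, baxter_three, baxter_four, baxter_five]
  | succ m =>
    change 0 ≤ logConvexOp baxter (m + 2) * logConvexOp baxter (m + 4) -
      logConvexOp baxter (m + 3) ^ 2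
    rw [logConvexOp_baxter _ (by omega), logConvexOp_baxter _ (by omega),
      logConvexOp_baxter _ (by omega)]
    have h := baxterExcess_sq_le m
    have hq : (baxterExcess (m + 3) + 1) * baxter (m + 4) ^ 2 =
        baxter (m + 3) * baxter (m + 5) := by
      have := logConvexOp_baxter (m + 3) (by omega)
      unfold logConvexOp at this
      linarith
    have hb := mul_le_mul_of_nonneg_left h (by positivity : 0 ≤ (baxter (m + 4) ^ 2) ^ 2)
    have : (baxter (m + 4) ^ 2) ^ 2 * ((baxterExcess (m + 3) + 1) ^ 2 *
        (baxterExcess (m + 2) * baxterExcess (m + 4))) = (baxter (m + 3) * baxter (m + 5)) ^ 2 *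
        (baxterExcess (m + 2) * baxterExcess (m + 4)) := by
      rw [← hq]; ring
    rw [this] at hb
    simp only [add_assoc, Nat.reduceAdd]
    linarith

theorem isRLogConvex_two_baxterSeq : IsRLogConvex 2 baxterSeq := by
  intro j h1 h2 n
  obtain rfl | rfl : j = 1 ∨ j = 2 := by omega
  · exact logConvexOp_baxterSeq_nonneg n
  · exact logConvexOp_logConvexOp_baxterSeq_nonneg n

/-! ### Calculus of expansions in `n⁻¹` -/

open Filter Asymptotics Topology Polynomial in
/-- `f n` agrees with a polynomial in `n⁻¹` up to an error `O(n⁻ᴷ)`. -/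
def HasInvExpansion (K : ℕ) (f : ℕ → ℝ) : Prop :=
  ∃ P : ℝ[X], (fun n : ℕ => f n - P.eval (n : ℝ)⁻¹) =O[atTop] fun n : ℕ => (n : ℝ)⁻¹ ^ K

namespace HasInvExpansion

open Filter Asymptotics Topology Polynomial

variable {K : ℕ} {f g : ℕ → ℝ}

theorem tendsto_inv : Tendsto (fun n : ℕ => (n : ℝ)⁻¹) atTop (𝓝 0) :=
  tendsto_inv_atTop_nhds_zero_nat

theorem inv_pow_isBigO {j k : ℕ} (h : j ≤ k) :
    (fun n : ℕ => (n : ℝ)⁻¹ ^ k) =O[atTop] fun n : ℕ => (n : ℝ)⁻¹ ^ j := by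
  refine IsBigO.of_bound 1 ?_
  filter_upwards [eventually_ge_atTop 1] with n hn
  have hn' : (1 : ℝ) ≤ n := by exact_mod_cast hn
  rw [one_mul, Real.norm_of_nonneg (by positivity), Real.norm_of_nonneg (by positivity)]
  exact pow_le_pow_of_le_one (by positivity) (inv_le_one_of_one_le₀ hn') h

theorem tendsto_eval (P : ℝ[X]) :
    Tendsto (fun n : ℕ => P.eval (n : ℝ)⁻¹) atTop (𝓝 (P.eval 0)) :=
  (P.continuous.tendsto 0).comp tendsto_inv

theorem eval_isBigO_one (P : ℝ[X]) :
    (fun n : ℕ => P.eval (n : ℝ)⁻¹) =O[atTop] fun _ => (1 : ℝ) :=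
  (tendsto_eval P).isBigO_one ℝ

theorem of_eval (P : ℝ[X]) (K : ℕ) : HasInvExpansion K fun n => P.eval (n : ℝ)⁻¹ :=
  ⟨P, by simpa using isBigO_zero _ _⟩

theorem const (c : ℝ) (K : ℕ) : HasInvExpansion K fun _ => c := by
  simpa using of_eval (C c) K

theorem inv_nat (K : ℕ) : HasInvExpansion K fun n => (n : ℝ)⁻¹ := by
  simpa using of_eval X K

theorem of_isBigO (hg : HasInvExpansion K g)
    (h : (fun n => f n - g n) =O[atTop] fun n : ℕ => (n : ℝ)⁻¹ ^ K) : HasInvExpansion K f := by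
  obtain ⟨P, hP⟩ := hg
  exact ⟨P, (h.add hP).congr_left fun n => by ring⟩

theorem congr (hg : HasInvExpansion K g) (h : f =ᶠ[atTop] g) : HasInvExpansion K f := by
  refine hg.of_isBigO (EventuallyEq.trans_isBigO ?_ (isBigO_zero _ _))
  filter_upwards [h] with n hn
  simp [hn]

theorem isBigO_one (hf : HasInvExpansion K f) : f =O[atTop] fun _ => (1 : ℝ) := by
  obtain ⟨P, hP⟩ := hf
  have h1 := hP.trans (inv_pow_isBigO (Nat.zero_le K))
  simp only [pow_zero] at h1
  exact (h1.add (eval_isBigO_one P)).congr_left fun n => by ring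

theorem mono {j : ℕ} (hf : HasInvExpansion K f) (h : j ≤ K) : HasInvExpansion j f := by
  obtain ⟨P, hP⟩ := hf
  exact ⟨P, hP.trans (inv_pow_isBigO h)⟩

theorem add (hf : HasInvExpansion K f) (hg : HasInvExpansion K g) :
    HasInvExpansion K fun n => f n + g n := by
  obtain ⟨P, hP⟩ := hf
  obtain ⟨Q, hQ⟩ := hg
  exact ⟨P + Q, (hP.add hQ).congr_left fun n => by rw [eval_add]; ring⟩

theorem mul (hf : HasInvExpansion K f) (hg : HasInvExpansion K g) :
    HasInvExpansion K fun n => f n * g n := by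
  have hf1 := hf.isBigO_one
  obtain ⟨P, hP⟩ := hf
  obtain ⟨Q, hQ⟩ := hg
  have h1 := hf1.mul hQ
  have h2 := hP.mul (eval_isBigO_one Q)
  simp only [mul_one, one_mul] at h1 h2
  exact ⟨P * Q, (h1.add h2).congr_left fun n => by rw [eval_mul]; ring⟩

theorem neg (hf : HasInvExpansion K f) : HasInvExpansion K fun n => -f n := by
  simpa using (const (-1) K).mul hf

theorem sub (hf : HasInvExpansion K f) (hg : HasInvExpansion K g) :
    HasInvExpansion K fun n => f n - g n := by
  simpa [sub_eq_add_neg] using hf.add hg.neg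

theorem pow (hf : HasInvExpansion K f) (m : ℕ) : HasInvExpansion K fun n => f n ^ m := by
  induction m with
  | zero => simpa using const 1 K
  | succ m ih => simpa [pow_succ] using ih.mul hf

theorem sum {ι : Type*} (s : Finset ι) (F : ι → ℕ → ℝ) (h : ∀ i ∈ s, HasInvExpansion K (F i)) :
    HasInvExpansion K fun n => ∑ i ∈ s, F i n := by
  classical
  induction s using Finset.induction_on with
  | empty => simpa using const 0 K
  | insert a s ha ih =>
    simp only [Finset.sum_insert ha]
    exact (h a (by simp)).add (ih fun i hi => h i (by simp [hi]))

theorem eval_comp (hf : HasInvExpansion K f) (P : ℝ[X]) :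
    HasInvExpansion K fun n => P.eval (f n) := by
  simp only [eval_eq_sum, Polynomial.sum]
  exact sum _ _ fun i _ => (const _ K).mul (hf.pow i)

theorem sub_eval_tendsto {P : ℝ[X]}
    (hP : (fun n : ℕ => f n - P.eval (n : ℝ)⁻¹) =O[atTop] fun n : ℕ => (n : ℝ)⁻¹ ^ (K + 1)) :
    Tendsto f atTop (𝓝 (P.eval 0)) := by
  have h1 : Tendsto (fun n : ℕ => (n : ℝ)⁻¹ ^ (K + 1)) atTop (𝓝 0) := by
    simpa using tendsto_inv.pow (K + 1)
  simpa using (hP.trans_tendsto h1).add (tendsto_eval P)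

theorem exists_tendsto (hf : HasInvExpansion (K + 1) f) : ∃ c, Tendsto f atTop (𝓝 c) :=
  hf.elim fun _ hP => ⟨_, sub_eval_tendsto hP⟩

/-- A zero limit kills the constant coefficient, so `X` divides the polynomial; one order of
precision is lost. -/
theorem nat_mul (hf : HasInvExpansion (K + 1) f) (h0 : Tendsto f atTop (𝓝 0)) :
    HasInvExpansion K fun n => n * f n := by
  obtain ⟨P, hP⟩ := hf
  have hP0 : P.eval 0 = 0 := tendsto_nhds_unique (sub_eval_tendsto hP) h0
  obtain ⟨Q, rfl⟩ : X ∣ P := X_dvd_iff.2 (by rwa [coeff_zero_eq_eval_zero])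
  refine ⟨Q, ?_⟩
  have h := (isBigO_refl (fun n : ℕ => (n : ℝ)) atTop).mul hP
  refine (EventuallyEq.trans_isBigO ?_ h).trans_eventuallyEq ?_
  · filter_upwards [eventually_ne_atTop 0] with n hn
    have : (n : ℝ) ≠ 0 := by exact_mod_cast hn
    rw [eval_mul, eval_X]
    field_simp
  · filter_upwards [eventually_ne_atTop 0] with n hn
    have : (n : ℝ) ≠ 0 := by exact_mod_cast hn
    rw [pow_succ]
    field_simp

theorem isBigO_inv (hf : HasInvExpansion (K + 1) f) (h0 : Tendsto f atTop (𝓝 0)) :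
    f =O[atTop] fun n : ℕ => (n : ℝ)⁻¹ := by
  have h := (isBigO_refl (fun n : ℕ => (n : ℝ)⁻¹) atTop).mul (hf.nat_mul h0).isBigO_one
  simp only [mul_one] at h
  refine EventuallyEq.trans_isBigO ?_ h
  filter_upwards [eventually_ne_atTop 0] with n hn
  have : (n : ℝ) ≠ 0 := by exact_mod_cast hn
  field_simp

theorem nat_pow_mul {j : ℕ} (hf : HasInvExpansion (K + j) f)
    (h : f =O[atTop] fun n : ℕ => (n : ℝ)⁻¹ ^ j) :
    HasInvExpansion K fun n => (n : ℝ) ^ j * f n := by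
  induction j generalizing f with
  | zero => simpa using hf
  | succ j ih =>
    have h1 : Tendsto (fun n : ℕ => (n : ℝ)⁻¹ ^ (j + 1)) atTop (𝓝 0) := by
      simpa using tendsto_inv.pow (j + 1)
    have h2 := ih (hf.nat_mul (h.trans_tendsto h1)) ?_
    · simpa only [pow_succ, mul_assoc] using h2
    · refine ((isBigO_refl (fun n : ℕ => (n : ℝ)) atTop).mul h).trans_eventuallyEq ?_
      filter_upwards [eventually_ne_atTop 0] with n hn
      have : (n : ℝ) ≠ 0 := by exact_mod_cast hn
      rw [pow_succ]
      field_simp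

/-- Truncated geometric series in `g = 1 - f/c = O(1/n)`, with remainder `g^(K+1)/f`. -/
theorem inv {c : ℝ} (hf : HasInvExpansion (K + 1) f) (hc : Tendsto f atTop (𝓝 c)) (h0 : c ≠ 0) :
    HasInvExpansion (K + 1) fun n => (f n)⁻¹ := by
  have hg : HasInvExpansion (K + 1) fun n => 1 - c⁻¹ * f n :=
    (const 1 _).sub ((const _ _).mul hf)
  have hg0 : Tendsto (fun n => 1 - c⁻¹ * f n) atTop (𝓝 0) := by
    simpa [h0] using (hc.const_mul c⁻¹).const_sub 1
  have hgO := hg.isBigO_inv hg0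
  have hs := (const c⁻¹ (K + 1)).mul
    (sum (Finset.range (K + 1)) _ fun i _ => hg.pow i)
  refine hs.of_isBigO ?_
  have hb := (hgO.pow (K + 1)).mul ((hc.inv₀ h0).isBigO_one ℝ)
  simp only [mul_one] at hb
  refine EventuallyEq.trans_isBigO ?_ hb
  filter_upwards [hc.eventually_ne h0] with n hn
  have key := geom_sum_mul_neg (1 - c⁻¹ * f n) (K + 1)
  rw [sub_sub_cancel] at key
  field_simp at key ⊢
  linarith

theorem inv_succ (K : ℕ) : HasInvExpansion (K + 1) fun n => ((n + 1 : ℕ) : ℝ)⁻¹ := by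
  have h1 : Tendsto (fun n : ℕ => 1 + (n : ℝ)⁻¹) atTop (𝓝 1) := by
    simpa using tendsto_inv.const_add 1
  refine ((inv_nat _).mul (((const 1 (K + 1)).add (inv_nat _)).inv h1 one_ne_zero)).congr ?_
  filter_upwards [eventually_ne_atTop 0] with n hn
  have : (n : ℝ) ≠ 0 := by exact_mod_cast hn
  push_cast
  field_simp

theorem inv_succ_isBigO :
    (fun n : ℕ => ((n + 1 : ℕ) : ℝ)⁻¹) =O[atTop] fun n : ℕ => (n : ℝ)⁻¹ := by
  refine (inv_succ 0).isBigO_inv ?_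
  exact tendsto_inv.comp (tendsto_add_atTop_nat 1)

theorem shift (hf : HasInvExpansion (K + 1) f) : HasInvExpansion (K + 1) fun n => f (n + 1) := by
  obtain ⟨P, hP⟩ := hf
  refine ((inv_succ K).eval_comp P).of_isBigO ?_
  exact (hP.comp_tendsto (tendsto_add_atTop_nat 1)).trans (inv_succ_isBigO.pow (K + 1))

theorem one_of_isBigO {c : ℝ}
    (h : (fun n => f n - c) =O[atTop] fun n : ℕ => (n : ℝ)⁻¹) : HasInvExpansion 1 f :=
  (const c 1).of_isBigO (by simpa using h)

end HasInvExpansion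

/-! ### Expansions from recurrences, and differencing -/

open Filter Asymptotics Topology Polynomial

theorem isBigO_inv_of_contraction {e γ δ : ℕ → ℝ}
    (he : ∀ᶠ n in atTop, e (n + 1) = γ n + δ n * e n)
    (hδ : ∀ᶠ n in atTop, |δ n| ≤ 1 / 2)
    (hγ : γ =O[atTop] fun n : ℕ => (n : ℝ)⁻¹) : e =O[atTop] fun n : ℕ => (n : ℝ)⁻¹ := by
  obtain ⟨C, hC⟩ := hγ.bound
  obtain ⟨N, hN⟩ := eventually_atTop.1 ((he.and hδ).and (hC.and (eventually_ge_atTop 3)))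
  -- The induction step gives `(1/4 + 1/2) M/n ≤ M/(n + 1)`, which needs `n ≥ 3`.
  refine IsBigO.of_bound (max (4 * C) (|e N| * N)) ?_
  set M := max (4 * C) (|e N| * N)
  have h4 : 4 * C ≤ M := le_max_left _ _
  have hM : 0 ≤ M := le_trans (by positivity) (le_max_right _ _)
  filter_upwards [eventually_ge_atTop N] with n hn
  rw [norm_inv, Real.norm_natCast, Real.norm_eq_abs, ← div_eq_mul_inv]
  induction n, hn using Nat.le_induction with
  | base =>
    have : 0 < (N : ℝ) := by
      have := (hN N le_rfl).2.2
      exact_mod_cast (by omega : 0 < N)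
    rw [le_div_iff₀ this]
    exact le_max_right _ _
  | succ n hn ih =>
    obtain ⟨⟨h1, h2⟩, h3, h5⟩ := hN n hn
    have hn3 : (3 : ℝ) ≤ n := by exact_mod_cast h5
    have hn0 : (0 : ℝ) < n := by linarith
    rw [norm_inv, Real.norm_natCast, Real.norm_eq_abs, ← div_eq_mul_inv] at h3
    have h6 : |δ n * e n| ≤ 1 / 2 * (M / n) := by
      rw [abs_mul]
      gcongr
    have h7 : C / n ≤ M / 4 / n := by
      gcongr
      linarith
    rw [h1]
    calc |γ n + δ n * e n| ≤ M / 4 / n + 1 / 2 * (M / n) :=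
          (abs_add_le _ _).trans (add_le_add (h3.trans h7) h6)
      _ = 3 * M / (4 * n) := by field_simp; ring
      _ ≤ M / (n + 1 : ℕ) := by
        push_cast
        rw [div_le_div_iff₀ (by positivity) (by positivity)]
        nlinarith

/-- A solution of a first order rational recurrence converging to an attracting fixed point
inherits expansions in powers of `n⁻¹` from the coefficients. -/
theorem HasInvExpansion.of_recurrence {q α β : ℕ → ℝ} {a L : ℝ}
    (hα : ∀ K, HasInvExpansion K α) (hβ : ∀ K, HasInvExpansion K β)
    (ha : Tendsto α atTop (𝓝 a)) (hL : 0 < L)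
    (hcontr : |L - a| < L / 2)
    (hq : (fun n => q n - L) =O[atTop] fun n : ℕ => (n : ℝ)⁻¹)
    (hrec : ∀ᶠ n in atTop, q (n + 1) * q n = α n * q n + β n) (K : ℕ) :
    HasInvExpansion (K + 1) q := by
  have hq1 : HasInvExpansion 1 q := one_of_isBigO hq
  have hqL : Tendsto q atTop (𝓝 L) := by
    simpa using (hq.trans_tendsto tendsto_inv).add_const L
  induction K with
  | zero => exact hq1
  | succ K ih =>
    obtain ⟨P, hP⟩ := ih
    have hPL : P.eval 0 = L := tendsto_nhds_unique (sub_eval_tendsto hP) hqL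
    let p : ℕ → ℝ := fun n => P.eval (n : ℝ)⁻¹
    have hp : ∀ k, HasInvExpansion k p := of_eval P
    have hpL : Tendsto p atTop (𝓝 L) := hPL ▸ tendsto_eval P
    have hp' : ∀ k, HasInvExpansion (k + 1) fun n => p (n + 1) := fun k => (hp (k + 1)).shift
    have hpL' : Tendsto (fun n => p (n + 1)) atTop (𝓝 L) := hpL.comp (tendsto_add_atTop_nat 1)
    -- The rescaled error satisfies `e (n + 1) = γ n + δ n * e n` with `γ → r`, `δ → d`, `|d| <
    -- 1/2`. It therefore approaches the fixed point `c = r/(1 - d)` at rate `1/n`, and `c` is the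
    -- next coefficient.
    let e : ℕ → ℝ := fun n => (n : ℝ) ^ (K + 1) * (q n - p n)
    have he : e =O[atTop] fun _ => (1 : ℝ) := by
      refine ((isBigO_refl (fun n : ℕ => (n : ℝ) ^ (K + 1)) atTop).mul hP).trans_eventuallyEq ?_
      filter_upwards [eventually_ne_atTop 0] with n hn
      have : (n : ℝ) ≠ 0 := by exact_mod_cast hn
      rw [← mul_pow, mul_inv_cancel₀ this, one_pow]
    -- Defect of the approximant `p` in the recurrence.
    let R : ℕ → ℝ := fun n => p (n + 1) * p n - α n * p n - β n
    have hR : ∀ k, HasInvExpansion (k + 1) R := fun k =>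
      (((hp' k).mul (hp _)).sub ((hα _).mul (hp _))).sub (hβ _)
    have hP' : (fun n => q (n + 1) - p (n + 1)) =O[atTop] fun n : ℕ => (n : ℝ)⁻¹ ^ (K + 1) :=
      (hP.comp_tendsto (tendsto_add_atTop_nat 1)).trans (inv_succ_isBigO.pow (K + 1))
    have hRO : R =O[atTop] fun n : ℕ => (n : ℝ)⁻¹ ^ (K + 1) := by
      have h1 := hP'.mul (hqL.isBigO_one ℝ)
      have h2 := ((hpL'.sub ha).isBigO_one ℝ).mul hP
      simp only [mul_one, one_mul] at h1 h2
      refine EventuallyEq.trans_isBigO ?_ (h1.add h2).neg_left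
      filter_upwards [hrec] with n hn
      simp only [R, p] at *
      linarith
    let R' : ℕ → ℝ := fun n => (n : ℝ) ^ (K + 1) * R n
    have hR' : HasInvExpansion 1 R' :=
      nat_pow_mul (by rw [add_comm]; exact hR (K + 1)) hRO
    let ψ : ℕ → ℝ := fun n => (1 + (n : ℝ)⁻¹) ^ (K + 1) * (q n)⁻¹
    have hψ : HasInvExpansion 1 ψ :=
      (((const 1 1).add (inv_nat 1)).pow (K + 1)).mul (inv (K := 0) hq1 hqL hL.ne')
    have hψL : Tendsto ψ atTop (𝓝 L⁻¹) := by
      simpa using ((tendsto_inv.const_add 1).pow (K + 1)).mul (hqL.inv₀ hL.ne')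
    let δ : ℕ → ℝ := fun n => -(ψ n * (p (n + 1) - α n))
    let γ : ℕ → ℝ := fun n => -(ψ n * R' n)
    have hδ : HasInvExpansion 1 δ := (hψ.mul ((hp' 0).sub (hα 1))).neg
    have hγ : HasInvExpansion 1 γ := (hψ.mul hR').neg
    have hδL : Tendsto δ atTop (𝓝 (-(L⁻¹ * (L - a)))) := (hψL.mul (hpL'.sub ha)).neg
    obtain ⟨r, hr⟩ := exists_tendsto (K := 0) hγ
    have hd : |-(L⁻¹ * (L - a))| < 1 / 2 := by
      rw [abs_neg, abs_mul, abs_of_pos (inv_pos.2 hL), inv_mul_lt_iff₀ hL]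
      linarith
    set d := -(L⁻¹ * (L - a))
    have hd1 : 1 - d ≠ 0 := by
      have := (abs_lt.1 hd).2
      linarith
    have hstep : ∀ᶠ n in atTop, e (n + 1) = γ n + δ n * e n := by
      filter_upwards [hrec, eventually_ne_atTop 0, hqL.eventually_ne hL.ne'] with n h1 h2 h3
      have hn : (n : ℝ) ≠ 0 := by exact_mod_cast h2
      have h4 : ((n + 1 : ℕ) : ℝ) ^ (K + 1) = (1 + (n : ℝ)⁻¹) ^ (K + 1) * (n : ℝ) ^ (K + 1) := by
        rw [← mul_pow]
        congr 1
        push_cast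
        field_simp
      have h5 : q (n + 1) - p (n + 1) =
          -((q n)⁻¹ * (R n + (q n - p n) * (p (n + 1) - α n))) := by
        simp only [R]
        field_simp
        linarith
      simp only [e, γ, δ, ψ, R']
      rw [h4, h5]
      ring
    let c := r / (1 - d)
    have hcontrO : (fun n => e n - c) =O[atTop] fun n : ℕ => (n : ℝ)⁻¹ := by
      refine isBigO_inv_of_contraction (γ := fun n => γ n + δ n * c - c) (δ := δ) ?_ ?_ ?_
      · filter_upwards [hstep] with n hn
        rw [hn]
        ring
      · filter_upwards [hδL.abs.eventually_lt_const hd] with n hn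
        exact hn.le
      · refine isBigO_inv (K := 0) ((hγ.add (hδ.mul (const c 1))).sub (const c 1)) ?_
        have h0 : r + d * c - c = 0 := by
          simp only [c]
          field_simp
          ring
        rw [← h0]
        exact (hr.add (hδL.mul_const c)).sub_const c
    have hfin : HasInvExpansion (K + 1 + 1) fun n => p n + c * (n : ℝ)⁻¹ ^ (K + 1) :=
      (hp _).add ((const _ _).mul ((inv_nat _).pow _))
    refine hfin.of_isBigO ?_
    refine (EventuallyEq.trans_isBigO ?_
      ((isBigO_refl (fun n : ℕ => (n : ℝ)⁻¹ ^ (K + 1)) atTop).mul hcontrO)).trans_eventuallyEq ?_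
    · filter_upwards [eventually_ne_atTop 0] with n hn
      have : (n : ℝ) ≠ 0 := by exact_mod_cast hn
      have h1 : (n : ℝ)⁻¹ ^ (K + 1) * (n : ℝ) ^ (K + 1) = 1 := by
        rw [← mul_pow, inv_mul_cancel₀ this, one_pow]
      simp only [e]
      linear_combination -(q n - p n) * h1
    · filter_upwards with n
      rw [← pow_succ]

/-- Differencing gains a power of `n` because of the expansion; a size bound alone would not do.
Induct through `g n = n * f n`: the difference of `f` is `(g (n+1) - g n)/(n+1) - g n/(n(n+1))`. -/
theorem HasInvExpansion.isBigO_diff {f : ℕ → ℝ} {j : ℕ} (hf : ∀ K, HasInvExpansion K f)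
    (h : f =O[atTop] fun n : ℕ => (n : ℝ)⁻¹ ^ j) :
    (fun n => f (n + 1) - f n) =O[atTop] fun n : ℕ => (n : ℝ)⁻¹ ^ (j + 1) := by
  induction j generalizing f with
  | zero =>
    obtain ⟨c, hc⟩ := exists_tendsto (hf 1)
    simp only [zero_add, pow_one]
    refine isBigO_inv (K := 0) ((hf 1).shift.sub (hf 1)) ?_
    simpa using (hc.comp (tendsto_add_atTop_nat 1)).sub hc
  | succ j ih =>
    have h0 : Tendsto f atTop (𝓝 0) := by
      refine h.trans_tendsto ?_
      simpa using tendsto_inv.pow (j + 1)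
    have hg : ∀ K, HasInvExpansion K fun n => n * f n := fun K => (hf (K + 1)).nat_mul h0
    have hgO : (fun n : ℕ => n * f n) =O[atTop] fun n : ℕ => (n : ℝ)⁻¹ ^ j := by
      refine ((isBigO_refl (fun n : ℕ => (n : ℝ)) atTop).mul h).trans_eventuallyEq ?_
      filter_upwards [eventually_ne_atTop 0] with n hn
      have : (n : ℝ) ≠ 0 := by exact_mod_cast hn
      rw [pow_succ]
      field_simp
    have h1 := inv_succ_isBigO.mul (ih hg hgO)
    have h2 := (inv_succ_isBigO.mul (isBigO_refl (fun n : ℕ => (n : ℝ)⁻¹) atTop)).mul hgO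
    refine (EventuallyEq.trans_isBigO ?_ ((h1.trans_eventuallyEq ?_).sub
      (h2.trans_eventuallyEq ?_)))
    · filter_upwards [eventually_ne_atTop 0] with n hn
      have : (n : ℝ) ≠ 0 := by exact_mod_cast hn
      push_cast
      field_simp
      ring
    · exact Eventually.of_forall fun n => by simp only; ring
    · exact Eventually.of_forall fun n => by simp only; ring

/-! ### Sequences `1 + c/n² + ⋯` -/

/-- `f n = 1 + c / n ^ 2 + O(1 / n ^ 3)`, with an expansion in powers of `n⁻¹` to all orders. -/
def IsOneAddInvSq (f : ℕ → ℝ) (c : ℝ) : Prop :=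
  ∃ u : ℕ → ℝ, (∀ K, HasInvExpansion K u) ∧ Tendsto u atTop (𝓝 c) ∧
    ∀ᶠ n : ℕ in atTop, f n = 1 + (n : ℝ)⁻¹ ^ 2 * u n

namespace IsOneAddInvSq

open HasInvExpansion

variable {f g : ℕ → ℝ} {c d : ℝ}

theorem congr (hg : IsOneAddInvSq g c) (h : f =ᶠ[atTop] g) : IsOneAddInvSq f c := by
  obtain ⟨u, hu, huc, hgu⟩ := hg
  exact ⟨u, hu, huc, by filter_upwards [h, hgu] with n h1 h2 using h1.trans h2⟩

theorem mul (hf : IsOneAddInvSq f c) (hg : IsOneAddInvSq g d) :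
    IsOneAddInvSq (fun n => f n * g n) (c + d) := by
  obtain ⟨u, hu, huc, hfu⟩ := hf
  obtain ⟨v, hv, hvd, hgv⟩ := hg
  refine ⟨fun n => u n + v n + (n : ℝ)⁻¹ ^ 2 * (u n * v n), fun K => ?_, ?_, ?_⟩
  · exact ((hu K).add (hv K)).add (((inv_nat K).pow 2).mul ((hu K).mul (hv K)))
  · simpa using (huc.add hvd).add ((tendsto_inv.pow 2).mul (huc.mul hvd))
  · filter_upwards [hfu, hgv] with n h1 h2
    rw [h1, h2]
    ring

theorem shift (hf : IsOneAddInvSq f c) : IsOneAddInvSq (fun n => f (n + 1)) c := by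
  obtain ⟨u, hu, huc, hfu⟩ := hf
  refine ⟨fun n => (1 - ((n + 1 : ℕ) : ℝ)⁻¹) ^ 2 * u (n + 1), fun K => ?_, ?_, ?_⟩
  · exact ((((const 1 _).sub (inv_succ K)).pow 2).mul (hu (K + 1)).shift).mono (Nat.le_succ K)
  · have h1 := tendsto_inv.comp (tendsto_add_atTop_nat 1)
    simpa using ((h1.const_sub 1).pow 2).mul (huc.comp (tendsto_add_atTop_nat 1))
  · filter_upwards [(tendsto_add_atTop_nat 1).eventually hfu, eventually_ne_atTop 0] with n h1 h2
    have : (n : ℝ) ≠ 0 := by exact_mod_cast h2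
    rw [h1]
    push_cast
    field_simp
    ring

theorem succ_sq_div : IsOneAddInvSq (fun n : ℕ => ((n : ℝ) + 1) ^ 2 / (n * (n + 2))) 1 := by
  have h2 : ∀ K, HasInvExpansion (K + 1) fun n => ((n + 1 + 1 : ℕ) : ℝ)⁻¹ :=
    fun K => (inv_succ K).shift
  refine ⟨fun n => 1 - 2 * ((n + 1 + 1 : ℕ) : ℝ)⁻¹, fun K => ?_, ?_, ?_⟩
  · exact ((const 1 _).sub ((const 2 _).mul (h2 K))).mono (Nat.le_succ K)
  · have h1 := tendsto_inv.comp (tendsto_add_atTop_nat 2)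
    simpa [add_assoc, one_add_one_eq_two] using (h1.const_mul 2).const_sub 1
  · filter_upwards [eventually_ne_atTop 0] with n hn
    have : (n : ℝ) ≠ 0 := by exact_mod_cast hn
    have h2 : (n : ℝ) + 2 ≠ 0 := by positivity
    push_cast
    rw [add_assoc, one_add_one_eq_two]
    field_simp
    ring

/-- With `D` the difference of `u`, `u n * u (n+2) - u (n+1)²` equals `u n * (D (n+1) - D n) - (D
n)²`, which is `O(n⁻³)`. -/
theorem of_hasInvExpansion {u : ℕ → ℝ} (hu : ∀ K, HasInvExpansion K u)
    (huc : Tendsto u atTop (𝓝 c)) (hc : c ≠ 0) :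
    IsOneAddInvSq (fun n => u n * u (n + 2) / u (n + 1) ^ 2) 0 := by
  have hu1 : ∀ K, HasInvExpansion (K + 1) fun n => u (n + 1) := fun K => (hu _).shift
  have hu2 : ∀ K, HasInvExpansion (K + 1) fun n => u (n + 2) := fun K => (hu1 _).shift
  have hu1c : Tendsto (fun n => u (n + 1)) atTop (𝓝 c) := huc.comp (tendsto_add_atTop_nat 1)
  let D : ℕ → ℝ := fun n => u (n + 1) - u n
  have hD : ∀ K, HasInvExpansion K D := fun K => ((hu1 K).sub (hu _)).mono (Nat.le_succ K)
  have hDO : D =O[atTop] fun n : ℕ => (n : ℝ)⁻¹ ^ 2 := by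
    have h0 : Tendsto (fun n => u n - c) atTop (𝓝 0) := by simpa using huc.sub_const c
    have h1 : ∀ K, HasInvExpansion K fun n => u n - c := fun K => (hu K).sub (const c K)
    have h2 := isBigO_diff (j := 1) h1 (by simpa using (h1 1).isBigO_inv h0)
    exact h2.congr_left fun n => by simp only [D]; ring
  have hDD := isBigO_diff hD hDO
  let E : ℕ → ℝ := fun n => u n * u (n + 2) - u (n + 1) ^ 2
  have hE : ∀ K, HasInvExpansion K E := fun K =>
    (((hu _).mul (hu2 K)).sub ((hu1 K).pow 2)).mono (Nat.le_succ K)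
  have hEO : E =O[atTop] fun n : ℕ => (n : ℝ)⁻¹ ^ 3 := by
    have h1 := (huc.isBigO_one ℝ).mul hDD
    have h2 := (hDO.mul hDO).trans_eventuallyEq
      (g₂ := fun n : ℕ => (n : ℝ)⁻¹ ^ 4) (Eventually.of_forall fun n => by simp only; ring)
    simp only [one_mul] at h1
    refine (h1.sub (h2.trans (inv_pow_isBigO (by norm_num : 3 ≤ 4)))).congr_left fun n => ?_
    simp only [D, E]
    ring
  let F : ℕ → ℝ := fun n => (n : ℝ) ^ 3 * E n
  have hF : ∀ K, HasInvExpansion K F := fun K => nat_pow_mul (hE (K + 3)) hEO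
  obtain ⟨l, hl⟩ := exists_tendsto (hF 1)
  have hinv : ∀ K, HasInvExpansion (K + 1) fun n => (u (n + 1) ^ 2)⁻¹ := fun K =>
    inv ((hu1 K).pow 2) (hu1c.pow 2) (pow_ne_zero 2 hc)
  refine ⟨fun n => (n : ℝ)⁻¹ * (F n * (u (n + 1) ^ 2)⁻¹), fun K => ?_, ?_, ?_⟩
  · exact ((inv_nat _).mul ((hF _).mul (hinv K))).mono (Nat.le_succ K)
  · simpa using tendsto_inv.mul (hl.mul ((hu1c.pow 2).inv₀ (pow_ne_zero 2 hc)))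
  · filter_upwards [eventually_ne_atTop 0, hu1c.eventually_ne hc] with n hn hn2
    have : (n : ℝ) ≠ 0 := by exact_mod_cast hn
    simp only [F, E]
    field_simp
    ring

end IsOneAddInvSq

/-! ### A class stable under the operator -/

/-- `a` is eventually positive and `a n * a (n + 2) / a (n + 1) ^ 2 = 1 + c / n ^ 2 + ⋯` for some
`c > 0`. -/
def IsRegularlyLogConvex (a : ℕ → ℝ) : Prop :=
  (∀ᶠ n in atTop, 0 < a n) ∧
    ∃ c > 0, IsOneAddInvSq (fun n => a n * a (n + 2) / a (n + 1) ^ 2) c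

namespace IsRegularlyLogConvex

open HasInvExpansion

variable {a : ℕ → ℝ}

theorem shift (h : IsRegularlyLogConvex a) : IsRegularlyLogConvex fun n => a (n + 1) :=
  ⟨(tendsto_add_atTop_nat 1).eventually h.1,
    let ⟨c, hc, hac⟩ := h.2
    ⟨c, hc, hac.shift⟩⟩

/-- The image is `a (n+1)² n⁻² u n` with `u → c`. In its own quotient the three factors contribute
`2c`, `2` and `0`, so the new constant is `2c + 2 > 0`. -/
theorem logConvexOp (h : IsRegularlyLogConvex a) : IsRegularlyLogConvex (logConvexOp a) := by
  obtain ⟨hpos, c, hc, hac⟩ := h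
  have hS := hac.shift
  obtain ⟨u, hu, huc, hau⟩ := hac
  have hL : ∀ᶠ n : ℕ in atTop, _root_.logConvexOp a n = a (n + 1) ^ 2 * ((n : ℝ)⁻¹ ^ 2 * u n) := by
    filter_upwards [hau, (tendsto_add_atTop_nat 1).eventually hpos] with n h1 h2
    rw [_root_.logConvexOp, ← sub_eq_iff_eq_add'.2 h1]
    have := h2.ne'
    field_simp
  have hu0 : ∀ᶠ n in atTop, 0 < u n := huc.eventually_const_lt hc
  refine ⟨?_, _, ?_, (((hS.mul hS).mul
    (IsOneAddInvSq.succ_sq_div.mul IsOneAddInvSq.succ_sq_div)).mul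
      (IsOneAddInvSq.of_hasInvExpansion hu huc hc.ne')).congr ?_⟩
  · filter_upwards [hL, hu0, (tendsto_add_atTop_nat 1).eventually hpos,
      eventually_gt_atTop 0] with n h1 h2 h3 h4
    have : (0 : ℝ) < n := by exact_mod_cast h4
    rw [h1]
    positivity
  · positivity
  · filter_upwards [hL, (tendsto_add_atTop_nat 1).eventually hL,
      (tendsto_add_atTop_nat 2).eventually hL, (tendsto_add_atTop_nat 1).eventually hpos,
      (tendsto_add_atTop_nat 2).eventually hpos, (tendsto_add_atTop_nat 3).eventually hpos,
      eventually_gt_atTop 0, (tendsto_add_atTop_nat 1).eventually hu0] with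
      n h0 h1 h2 p1 p2 p3 hn hu1
    have hn' : (n : ℝ) ≠ 0 := by exact_mod_cast hn.ne'
    have hn1 : (n : ℝ) + 1 ≠ 0 := by positivity
    have hn2 : (n : ℝ) + 2 ≠ 0 := by positivity
    rw [h0, h1, h2]
    simp only [add_assoc, Nat.reduceAdd]
    push_cast
    have := p1.ne'
    have := p2.ne'
    have := p3.ne'
    have := hu1.ne'
    field_simp

theorem iterate_logConvexOp (h : IsRegularlyLogConvex a) (j : ℕ) :
    IsRegularlyLogConvex (_root_.logConvexOp^[j] a) := by
  induction j with
  | zero => exact h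
  | succ j ih =>
    rw [Function.iterate_succ_apply']
    exact ih.logConvexOp

theorem isAsymptoticallyRLogConvex (h : IsRegularlyLogConvex a) (r : ℕ) :
    IsAsymptoticallyRLogConvex r a := by
  intro j _ _
  obtain ⟨N, hN⟩ := eventually_atTop.1 (h.iterate_logConvexOp j).1
  exact ⟨N, fun n hn => (hN n hn).le⟩

end IsRegularlyLogConvex

/-! ### Application to the Baxter numbers -/

open HasInvExpansion in
theorem hasInvExpansion_div_quadratic (s t r : ℝ) (K : ℕ) :
    HasInvExpansion (K + 1)
      (fun n : ℕ => (s * (n : ℝ) ^ 2 + t * n + r) / (((n : ℝ) + 4) * (n + 5))) ∧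
    Tendsto (fun n : ℕ => (s * (n : ℝ) ^ 2 + t * n + r) / (((n : ℝ) + 4) * (n + 5))) atTop
      (𝓝 s) := by
  have hnum : HasInvExpansion (K + 1)
      fun n : ℕ => (C s + C t * X + C r * X ^ 2).eval (n : ℝ)⁻¹ := of_eval _ _
  have hden : HasInvExpansion (K + 1)
      fun n : ℕ => ((1 + 4 * X) * (1 + 5 * X) : ℝ[X]).eval (n : ℝ)⁻¹ := of_eval _ _
  have hnl := tendsto_eval (C s + C t * X + C r * X ^ 2)
  have hdl := tendsto_eval ((1 + 4 * X) * (1 + 5 * X) : ℝ[X])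
  simp only [eval_add, eval_mul, eval_C, eval_X, eval_pow, eval_one, eval_ofNat, mul_zero,
    add_zero, ne_eq, OfNat.ofNat_ne_zero, not_false_eq_true, zero_pow, mul_one] at *
  have heq : (fun n : ℕ => (s * (n : ℝ) ^ 2 + t * n + r) / (((n : ℝ) + 4) * (n + 5))) =ᶠ[atTop]
      fun n : ℕ => (s + t * (n : ℝ)⁻¹ + r * (n : ℝ)⁻¹ ^ 2) *
        ((1 + 4 * (n : ℝ)⁻¹) * (1 + 5 * (n : ℝ)⁻¹))⁻¹ := by
    filter_upwards [eventually_ne_atTop 0] with n hn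
    have : (n : ℝ) ≠ 0 := by exact_mod_cast hn
    have h4 : (n : ℝ) + 4 ≠ 0 := by positivity
    have h5 : (n : ℝ) + 5 ≠ 0 := by positivity
    field_simp
  refine ⟨(hnum.mul (hden.inv hdl one_ne_zero)).congr heq, ?_⟩
  refine Tendsto.congr' heq.symm ?_
  simpa using hnl.mul (hdl.inv₀ one_ne_zero)

theorem ratioLower_ge {m : ℝ} (hm : 0 ≤ m) : 8 - 180 / (m + 5) ≤ ratioLower (m + 5) := by
  unfold ratioLower
  rw [sub_div' (by positivity), div_le_div_iff₀ (by positivity) (by positivity), ← sub_nonneg]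
  ring_nf
  positivity

theorem ratioUpper_le {m : ℝ} (hm : 0 ≤ m) : ratioUpper (m + 5) ≤ 8 + 180 / (m + 5) := by
  unfold ratioUpper
  rw [add_div' _ _ _ (by positivity), div_le_div_iff₀ (by positivity) (by positivity),
    ← sub_nonneg]
  ring_nf
  positivity

theorem baxterRatio_sub_isBigO :
    (fun n => baxterRatio n - 8) =O[atTop] fun n : ℕ => (n : ℝ)⁻¹ := by
  refine IsBigO.of_bound 180 ?_
  filter_upwards [eventually_ge_atTop 2] with n hn
  obtain ⟨m, rfl⟩ := Nat.exists_eq_add_of_le' hn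
  have hm : (0 : ℝ) ≤ m := m.cast_nonneg
  have h1 := (ratioLower_ge hm).trans (baxterRatio_bounds m).1
  have h2 := (baxterRatio_bounds m).2.trans (ratioUpper_le hm)
  have h3 : (180 : ℝ) / (m + 5) ≤ 180 / (m + 2) := by
    gcongr
    norm_num
  rw [norm_inv, Real.norm_natCast, Real.norm_eq_abs, ← div_eq_mul_inv, abs_le]
  push_cast
  constructor <;> linarith

theorem hasInvExpansion_baxterRatio (K : ℕ) : HasInvExpansion K baxterRatio := by
  -- The limit `8` is the positive root of `L² = 7L + 8`; the multiplier there is `-1/8`.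
  refine (HasInvExpansion.of_recurrence (a := 7) (L := 8)
    (fun K => (hasInvExpansion_div_quadratic 7 35 40 K).1.mono (Nat.le_succ K))
    (fun K => (hasInvExpansion_div_quadratic 8 8 0 K).1.mono (Nat.le_succ K))
    (hasInvExpansion_div_quadratic 7 35 40 0).2 (by norm_num) (by norm_num)
    baxterRatio_sub_isBigO ?_ K).mono (Nat.le_succ K)
  filter_upwards [eventually_ge_atTop 1] with n hn
  have := (baxterRatio_pos n hn).ne'
  rw [baxterRatio_succ n hn]
  have h4 : (n : ℝ) + 4 ≠ 0 := by positivity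
  have h5 : (n : ℝ) + 5 ≠ 0 := by positivity
  field_simp
  ring

/-- Used only to make the limiting constant `c` positive. -/
theorem one_le_sq_mul_baxterExcess (n : ℕ) (hn : 3 ≤ n) : 1 ≤ (n : ℝ) ^ 2 * baxterExcess n := by
  obtain ⟨m, rfl⟩ := Nat.exists_eq_add_of_le' hn
  have hm : (0 : ℝ) ≤ m := m.cast_nonneg
  have h := excessLower_le_baxterExcess (m + 1)
  rw [show m + 1 + 2 = m + 3 by ring] at h
  refine le_trans ?_ (mul_le_mul_of_nonneg_left h (by positivity))
  unfold excessLower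
  push_cast
  rw [← mul_div_assoc, one_le_div (by positivity), ← sub_nonneg]
  ring_nf
  positivity

open HasInvExpansion in
theorem isRegularlyLogConvex_baxter : IsRegularlyLogConvex baxter := by
  refine ⟨(eventually_ge_atTop 1).mono baxter_pos, ?_⟩
  have hq := hasInvExpansion_baxterRatio
  have hqL : Tendsto baxterRatio atTop (𝓝 8) := by
    simpa using (baxterRatio_sub_isBigO.trans_tendsto tendsto_inv).add_const 8
  have hD : ∀ K, HasInvExpansion K fun n => baxterRatio (n + 1) - baxterRatio n := fun K =>
    ((hq (K + 1)).shift.sub (hq _)).mono (Nat.le_succ K)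
  have hDO := isBigO_diff (j := 1) (fun K => (hq K).sub (const 8 K))
    (by simpa using baxterRatio_sub_isBigO)
  simp only [sub_sub_sub_cancel_right] at hDO
  have hu : ∀ K, HasInvExpansion (K + 1) fun n => (n : ℝ) ^ 2 * baxterExcess n := fun K => by
    refine ((nat_pow_mul (hD _) hDO).mul (inv (hq (K + 1)) hqL (by norm_num))).congr ?_
    filter_upwards [eventually_ge_atTop 1] with n hn
    have := (baxterRatio_pos n hn).ne'
    rw [baxterExcess]
    field_simp
    ring
  obtain ⟨c, hc⟩ := exists_tendsto (hu 0)
  have hc1 : 1 ≤ c := ge_of_tendsto hc ((eventually_ge_atTop 3).mono one_le_sq_mul_baxterExcess)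
  refine ⟨c, by linarith, _, fun K => (hu K).mono (Nat.le_succ K), hc, ?_⟩
  filter_upwards [eventually_ge_atTop 1] with n hn
  have hn0 : (n : ℝ) ≠ 0 := by positivity
  have h1 := (baxter_pos (n + 1) (by omega)).ne'
  have h := logConvexOp_baxter n hn
  unfold logConvexOp at h
  field_simp
  linarith

theorem theorem1p3 :
    (∀ r : ℕ, 1 ≤ r → IsAsymptoticallyRLogConvex r baxterSeq) ∧
      IsRLogConvex 2 baxterSeq :=
  ⟨fun r _ => isRegularlyLogConvex_baxter.shift.isAsymptoticallyRLogConvex r,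
    isRLogConvex_two_baxterSeq⟩
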